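/- Let $U$ be a unitary operator on a separable complex Hilbert space $H$ (inner product linear in the second variable), and let $\mathbb{T}$ be the unit circle. For $f\in C(\mathbb{T})$ let $f(U)$ be given by the continuous functional calculus of $U$. For $x\in H$ let $\mu_{x,x}$, the spectral measure of $U$ at $x$, be the unique finite Borel measure on $\mathbb{T}$ with $\int_{\mathbb{T}}f\,d\mu_{x,x}=\langle x,f(U)x\rangle$ for all $f\in C(\mathbb{T})$. (1) There exist a locally compact Hausdorff space $X$, a finite (regular) Borel measure $\nu$ on $X$, a continuous function $\varphi:X\to\mathbb{R}$, and a unitary map $\Theta:L^2(X,\nu)\to H$ such that $\Theta^{-1}U\Theta F=e^{i\varphi}F$ for all $F\in L^2(X,\nu)$. (2) Concretely, there are a set $A\subseteq\mathbb{N}$ (finite or infinite, possibly empty) and nonzero vectors $y_n\in H$ $(n\in A)$ such that $H$ is the orthogonal Hilbert sum of the closed cyclic subspaces $H_n=\overline{\{f(U)y_n: f\in C(\mathbb{T})\}}$; and, on $\mathbb{T}\times A$ (with $A$ discrete), there are a finite Borel measure $\nu$ which restricts to $\mu_{y_n,y_n}$ on each component $\mathbb{T}\times\{n\}$, a Borel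 function $\varphi:\mathbb{T}\times A\to\mathbb{R}$ with $e^{i\varphi(z,n)}=z$, and a unitary map $\Theta:L^2(\mathbb{T}\times A,\nu)\to H$ such that: - for $n\in A$ and $f\in C(\mathbb{T})$, $\Theta$ maps the function equal to $f$ on $\mathbb{T}\times\{n\}$ and to $0$ on the other components to $f(U)y_n$; - for all $F\in L^2(\mathbb{T}\times A,\nu)$, $\Theta^{-1}U\Theta F=e^{i\varphi}F$, that is, $(\Theta^{-1}U\Theta F)(z,n)=zF(z,n)$ for $\nu$-almost every $(z,n)$. -/

import Mathlib

open MeasureTheory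

noncomputable section

/-- The unit circle `𝕋` carries its Borel sigma-algebra. -/
instance instMeasurableSpaceUnitCircle : MeasurableSpace Circle := borel Circle

instance instBorelSpaceUnitCircle : BorelSpace Circle := ⟨rfl⟩

/-- The inclusion of the spectrum of a unitary operator in the unit circle, as a continuous map. -/
def spectrumToCircle {H : Type*} [NormedAddCommGroup H] [InnerProductSpace ℂ H] [CompleteSpace H]
    (U : unitary (H →L[ℂ] H)) : C(spectrum ℂ (U : H →L[ℂ] H), Circle) where
  toFun z := ⟨(z : ℂ), spectrum.subset_circle_of_unitary U.2 z.2⟩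
  continuous_toFun := by
    exact Continuous.subtype_mk continuous_subtype_val _

/-- The continuous calculus `f ↦ f(U)` of a unitary operator `U`, defined for `f ∈ C(𝕋)`:
restrict `f` to the spectrum of `U` and apply the continuous functional calculus. -/
def circleCalculus {H : Type*} [NormedAddCommGroup H] [InnerProductSpace ℂ H] [CompleteSpace H]
    (U : unitary (H →L[ℂ] H)) : C(Circle, ℂ) →⋆ₐ[ℂ] (H →L[ℂ] H) :=
  (cfcHom (R := ℂ) (p := IsStarNormal) (a := (U : H →L[ℂ] H)) inferInstance).comp
    (ContinuousMap.compStarAlgHom' ℂ ℂ (spectrumToCircle U))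

/-- The calculus maps the coordinate function `e^{it} ↦ e^{it}` to `U`. -/
theorem circleCalculus_coord {H : Type*} [NormedAddCommGroup H] [InnerProductSpace ℂ H]
    [CompleteSpace H] (U : unitary (H →L[ℂ] H)) :
    circleCalculus U ⟨fun z : Circle => (z : ℂ), continuous_subtype_val⟩ = (U : H →L[ℂ] H) :=
  cfcHom_id (R := ℂ) (p := IsStarNormal) (a := (U : H →L[ℂ] H)) inferInstance

/-- The calculus is contractive for the uniform norm on `C(𝕋)`. -/
theorem norm_circleCalculus_le {H : Type*} [NormedAddCommGroup H] [InnerProductSpace ℂ H]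
    [CompleteSpace H] (U : unitary (H →L[ℂ] H)) (f : C(Circle, ℂ)) :
    ‖circleCalculus U f‖ ≤ ‖f‖ :=
  NonUnitalStarAlgHom.norm_apply_le (circleCalculus U) f

/-- `μ` is the spectral measure `μ_{x,x}` of the unitary operator `U` at the vector `x`: the finite
Borel measure on `𝕋` with `∫ f dμ = ⟨x, f(U) x⟩` for all `f ∈ C(𝕋)`. -/
def IsSpectralMeasure {H : Type*} [NormedAddCommGroup H] [InnerProductSpace ℂ H] [CompleteSpace H]
    (U : unitary (H →L[ℂ] H)) (x : H) (μ : Measure Circle) : Prop :=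
  IsFiniteMeasure μ ∧ ∀ f : C(Circle, ℂ), ∫ z, f z ∂μ = inner ℂ x (circleCalculus U f x)

/-- The closed cyclic subspace generated by `y`: the closure of `{f(U) y : f ∈ C(𝕋)}`. -/
def cyclicSubspace {H : Type*} [NormedAddCommGroup H] [InnerProductSpace ℂ H] [CompleteSpace H]
    (U : unitary (H →L[ℂ] H)) (y : H) : Submodule ℂ H :=
  (LinearMap.range ((ContinuousLinearMap.apply ℂ H y).toLinearMap ∘ₗ
    (circleCalculus U).toAlgHom.toLinearMap)).topologicalClosure

/-- The function on `𝕋 × A` equal to `f` on the component `𝕋 × {n}` and to `0` elsewhere. -/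
def onComponent {A : Set ℕ} (n : A) (f : C(Circle, ℂ)) : Circle × A → ℂ :=
  fun p => if p.2 = n then f p.1 else 0

end

noncomputable section

/-! The functional f ↦ ⟨x, f(U)x⟩ on C(𝕋) is positive, because ⟨f(U)x, g(U)x⟩ = ⟨x, (f̄g)(U)x⟩;
Riesz–Markov turns it into a measure, and the same identity says that f ↦ f(U)x preserves the L²
inner product. By Zorn and separability, H is the Hilbert sum of countably many cyclic subspaces.
Hence the vectors f(U)yₙ and the functions equal to f on the n-th circle have the same Gram matrix,
and both families are total. Matching them gives Θ, and U becomes multiplication by z since U f(U) =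
(zf)(U).

Generators of norm 2⁻ⁿ make the union of the spectral measures finite. The phase arg z is Borel but
not continuous on 𝕋, so for the first model the measure is transported to ℝ × A along z ↦ arg z;
there the phase is the coordinate t. -/

/-- Two families with the same Gram matrix and with dense spans are related by a unitary map. -/
theorem exists_linearIsometryEquiv_of_inner_eq {𝕜 E F ι : Type*} [RCLike 𝕜]
    [NormedAddCommGroup E] [InnerProductSpace 𝕜 E] [CompleteSpace E]
    [NormedAddCommGroup F] [InnerProductSpace 𝕜 F] [CompleteSpace F]
    (a : ι → E) (b : ι → F) (hab : ∀ i j, inner 𝕜 (a i) (a j) = inner 𝕜 (b i) (b j))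
    (ha : Dense (Submodule.span 𝕜 (Set.range a) : Set E))
    (hb : Dense (Submodule.span 𝕜 (Set.range b) : Set F)) :
    ∃ Θ : E ≃ₗᵢ[𝕜] F, ∀ i, Θ (a i) = b i := by
  rw [← Finsupp.range_linearCombination] at ha hb
  -- The squared norm of a finite combination depends only on its coefficients and the Gram matrix,
  -- so matching coefficients is isometric on the spans.
  have hnorm (x : ι →₀ 𝕜) :
      ‖Finsupp.linearCombination 𝕜 b (LinearEquiv.refl 𝕜 _ x)‖ =
        ‖Finsupp.linearCombination 𝕜 a x‖ := by
    rw [norm_eq_sqrt_re_inner (𝕜 := 𝕜), norm_eq_sqrt_re_inner (𝕜 := 𝕜)]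
    simp only [LinearEquiv.refl_apply, Finsupp.linearCombination_apply, hab, inner_smul_left, inner_smul_right, Finsupp.sum, sum_inner, inner_sum]
  refine ⟨(LinearEquiv.refl 𝕜 (ι →₀ 𝕜)).extendOfIsometry _ _ ha hb hnorm,
    fun i => ?_⟩
  have h := (LinearEquiv.refl 𝕜 (ι →₀ 𝕜)).extendOfIsometry_eq _ _ ha hb hnorm
    (Finsupp.single i 1)
  simpa using h

/-! ### Spectral measures -/

variable {H : Type*} [NormedAddCommGroup H] [InnerProductSpace ℂ H] [CompleteSpace H]

/-- `⟨f(U) x, g(U) y⟩ = ⟨x, (f̄ g)(U) y⟩`. -/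
theorem inner_circleCalculus_circleCalculus (U : unitary (H →L[ℂ] H)) (f g : C(Circle, ℂ))
    (x y : H) :
    inner ℂ (circleCalculus U f x) (circleCalculus U g y) =
      inner ℂ x (circleCalculus U (star f * g) y) := by
  rw [map_mul, map_star, ContinuousLinearMap.star_eq_adjoint, mul_apply_eq_comp,
    ContinuousLinearMap.adjoint_inner_right]

/-- The embedding of real continuous functions into complex ones. -/
def circleOfReal : C(Circle, ℝ) →L[ℝ] C(Circle, ℂ) :=
  Complex.ofRealCLM.compLeftContinuous ℝ Circle

theorem circleOfReal_apply (f : C(Circle, ℝ)) (z : Circle) :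
    circleOfReal f z = (f z : ℂ) := rfl

theorem star_circleOfReal (f : C(Circle, ℝ)) : star (circleOfReal f) = circleOfReal f := by
  ext z
  simp [circleOfReal_apply]

/-- With g = √f one has f = ḡg, so the value is ‖g(U)x‖². -/
theorem re_inner_circleCalculus_nonneg (U : unitary (H →L[ℂ] H)) (x : H) (f : C(Circle, ℝ))
    (hf : ∀ z, 0 ≤ f z) : 0 ≤ (inner ℂ x (circleCalculus U (circleOfReal f) x)).re := by
  let g : C(Circle, ℝ) := ⟨fun z => √(f z), by fun_prop⟩
  have hg : circleOfReal f = star (circleOfReal g) * circleOfReal g := by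
    rw [star_circleOfReal]
    ext z
    simp only [ContinuousMap.mul_apply, circleOfReal_apply, g, ContinuousMap.coe_mk]
    rw [← Complex.ofReal_mul, Real.mul_self_sqrt (hf z)]
  rw [hg, ← inner_circleCalculus_circleCalculus]
  exact inner_self_nonneg (𝕜 := ℂ)

theorem im_inner_circleCalculus_eq_zero (U : unitary (H →L[ℂ] H)) (x : H) (f : C(Circle, ℝ)) :
    (inner ℂ x (circleCalculus U (circleOfReal f) x)).im = 0 := by
  rw [← Complex.conj_eq_iff_im, inner_conj_symm]
  have h := inner_circleCalculus_circleCalculus U (circleOfReal f) 1 x x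
  simpa [star_circleOfReal] using h

/-- The positive functional `f ↦ ⟨x, f(U) x⟩` on real continuous functions. -/
def spectralFunctional (U : unitary (H →L[ℂ] H)) (x : H) :
    CompactlySupportedContinuousMap Circle ℝ →ₚ[ℝ] ℝ :=
  PositiveLinearMap.mk₀
    { toFun := fun f => (inner ℂ x (circleCalculus U (circleOfReal f) x)).re
      map_add' := fun f g => by
        have h : ((f + g : CompactlySupportedContinuousMap Circle ℝ) : C(Circle, ℝ)) = f + g := rfl
        rw [h, map_add, map_add, add_apply, inner_add_right, Complex.add_re]
      map_smul' := fun c f => by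
        have h : circleOfReal ((c • f : CompactlySupportedContinuousMap Circle ℝ) : C(Circle, ℝ)) =
            (c : ℂ) • circleOfReal f := by
          ext z
          exact Complex.ofReal_mul _ _
        rw [h, map_smul, smul_apply, inner_smul_right, Complex.re_ofReal_mul]
        rfl }
    fun f hf => re_inner_circleCalculus_nonneg U x f hf

/-- Riesz–Markov gives the measure from real functions, finite because 𝕋 is compact; complex f are
handled through their real and imaginary parts. -/
theorem exists_isSpectralMeasure (U : unitary (H →L[ℂ] H)) (x : H) :
    ∃ μ : Measure Circle, IsSpectralMeasure U x μ := by
  have hfin : IsFiniteMeasure (RealRMK.rieszMeasure (spectralFunctional U x)) :=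
    ⟨isCompact_univ.measure_lt_top⟩
  refine ⟨RealRMK.rieszMeasure (spectralFunctional U x), hfin, fun f => ?_⟩
  have hreal (g : C(Circle, ℝ)) : ((∫ z, g z ∂(RealRMK.rieszMeasure (spectralFunctional U x)) : ℝ) : ℂ)
      = inner ℂ x (circleCalculus U (circleOfReal g) x) := by
    have h := RealRMK.integral_rieszMeasure (spectralFunctional U x)
      ⟨g, HasCompactSupport.of_compactSpace g⟩
    refine Complex.ext ?_ ?_
    · exact h
    · rw [im_inner_circleCalculus_eq_zero, Complex.ofReal_im]
  let fr : C(Circle, ℝ) := ⟨fun z => (f z).re, by fun_prop⟩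
  let fi : C(Circle, ℝ) := ⟨fun z => (f z).im, by fun_prop⟩
  have hf : f = circleOfReal fr + Complex.I • circleOfReal fi := by
    ext z
    change f z = ((f z).re : ℂ) + Complex.I * ((f z).im : ℂ)
    rw [mul_comm, Complex.re_add_im]
  have hint : Integrable (fun z => f z) (RealRMK.rieszMeasure (spectralFunctional U x)) :=
    f.continuous.integrable_of_hasCompactSupport (HasCompactSupport.of_compactSpace f)
  have h := integral_re_add_im hint
  rw [← h]
  conv_rhs => rw [hf]
  rw [map_add, map_smul, add_apply, smul_apply,
    inner_add_right, inner_smul_right, ← hreal, ← hreal, mul_comm Complex.I]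
  rfl

theorem IsSpectralMeasure.inner_eq_integral {U : unitary (H →L[ℂ] H)} {x : H} {μ : Measure Circle}
    (hμ : IsSpectralMeasure U x μ) (f g : C(Circle, ℂ)) :
    inner ℂ (circleCalculus U f x) (circleCalculus U g x) = ∫ z, star (f z) * g z ∂μ := by
  rw [inner_circleCalculus_circleCalculus, ← hμ.2]
  rfl

theorem IsSpectralMeasure.measure_univ {U : unitary (H →L[ℂ] H)} {x : H} {μ : Measure Circle}
    (hμ : IsSpectralMeasure U x μ) : μ Set.univ = ENNReal.ofReal (‖x‖ ^ 2) := by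
  have := hμ.1
  have h := hμ.2 1
  simp only [ContinuousMap.one_apply, integral_const, map_one, one_apply_eq_self,
    inner_self_eq_norm_sq_to_K] at h
  have h' : μ.real Set.univ = ‖x‖ ^ 2 := by
    have := congrArg Complex.re h
    simpa [← Complex.ofReal_pow] using this
  rw [← h', ofReal_measureReal]

/-! ### Decomposition into cyclic subspaces -/

theorem circleCalculus_mem_cyclicSubspace (U : unitary (H →L[ℂ] H)) (y : H) (f : C(Circle, ℂ)) :
    circleCalculus U f y ∈ cyclicSubspace U y :=
  Submodule.le_topologicalClosure _ ⟨f, rfl⟩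

theorem self_mem_cyclicSubspace (U : unitary (H →L[ℂ] H)) (y : H) : y ∈ cyclicSubspace U y := by
  simpa using circleCalculus_mem_cyclicSubspace U y 1

theorem cyclicSubspace_le {U : unitary (H →L[ℂ] H)} {y : H} {K : Submodule ℂ H}
    (hK : IsClosed (K : Set H)) (h : ∀ f, circleCalculus U f y ∈ K) : cyclicSubspace U y ≤ K := by
  refine Submodule.topologicalClosure_minimal _ ?_ hK
  rintro _ ⟨f, rfl⟩
  exact h f

/-- `y` and `z` generate orthogonal cyclic subspaces if `y ⟂ f(U) z` for all `f`. -/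
theorem isOrtho_cyclicSubspace {U : unitary (H →L[ℂ] H)} {y z : H}
    (h : ∀ f, inner ℂ y (circleCalculus U f z) = 0) : cyclicSubspace U y ⟂ cyclicSubspace U z := by
  refine cyclicSubspace_le (Submodule.isClosed_orthogonal _) fun f => ?_
  rw [Submodule.mem_orthogonal']
  suffices cyclicSubspace U z ≤ (ℂ ∙ circleCalculus U f y)ᗮ from fun w hw =>
    Submodule.mem_orthogonal_singleton_iff_inner_right.1 (this hw)
  refine cyclicSubspace_le (Submodule.isClosed_orthogonal _) fun g => ?_
  rw [Submodule.mem_orthogonal_singleton_iff_inner_right, inner_circleCalculus_circleCalculus]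
  exact h _

/-- A unit vector family whose cyclic subspaces are pairwise orthogonal. -/
def IsCyclicSystem (U : unitary (H →L[ℂ] H)) (S : Set H) : Prop :=
  (∀ v ∈ S, ‖v‖ = 1) ∧ S.Pairwise fun v w => cyclicSubspace U v ⟂ cyclicSubspace U w

theorem exists_maximal_isCyclicSystem (U : unitary (H →L[ℂ] H)) :
    ∃ S : Set H, Maximal (IsCyclicSystem U) S := by
  refine zorn_subset {S | IsCyclicSystem U S} fun c hc hchain => ⟨⋃₀ c, ⟨?_, ?_⟩, fun s hs =>
    Set.subset_sUnion_of_mem hs⟩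
  · rintro v ⟨s, hs, hv⟩
    exact (hc hs).1 v hv
  · exact (Set.pairwise_sUnion hchain.directedOn).2 fun s hs => (hc hs).2

/-- The vectors of the system are orthonormal, hence at distance √2 from each other; the balls of
radius 1/2 are disjoint open sets in a separable space. -/
theorem IsCyclicSystem.countable [TopologicalSpace.SeparableSpace H] {U : unitary (H →L[ℂ] H)}
    {S : Set H} (hS : IsCyclicSystem U S) : S.Countable := by
  refine Set.PairwiseDisjoint.countable_of_isOpen (s := fun v => Metric.ball v (1 / 2)) ?_
    (fun _ _ => Metric.isOpen_ball) (fun v _ => ⟨v, Metric.mem_ball_self (by norm_num)⟩)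
  intro v hv w hw hvw
  refine Metric.ball_disjoint_ball ?_
  have h0 : inner ℂ v w = 0 := (hS.2 hv hw hvw).inner_eq (self_mem_cyclicSubspace U v)
    (self_mem_cyclicSubspace U w)
  have h := @norm_sub_sq ℂ H _ _ _ v w
  rw [h0, hS.1 v hv, hS.1 w hw] at h
  rw [dist_eq_norm]
  norm_num at h ⊢
  nlinarith [norm_nonneg (v - w)]

/-- A unit vector orthogonal to all the cyclic subspaces generates another one orthogonal to them,
so it could be added to the system. -/
theorem dense_of_maximal_isCyclicSystem {U : unitary (H →L[ℂ] H)} {S : Set H}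
    (hS : Maximal (IsCyclicSystem U) S) :
    (⨆ v : S, cyclicSubspace U (v : H)).topologicalClosure = ⊤ := by
  rw [Submodule.topologicalClosure_eq_top_iff, Submodule.eq_bot_iff]
  intro w hw
  by_contra hw0
  let u : H := ((‖w‖⁻¹ : ℝ) : ℂ) • w
  have hu : u ∈ (⨆ v : S, cyclicSubspace U (v : H))ᗮ := Submodule.smul_mem _ _ hw
  have hu1 : ‖u‖ = 1 := by
    simp [u, norm_smul, hw0]
  have hortho (v : H) (hv : v ∈ S) : cyclicSubspace U v ⟂ cyclicSubspace U u := by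
    refine (isOrtho_cyclicSubspace fun f => ?_).symm
    rw [Submodule.mem_orthogonal'] at hu
    exact hu _ (le_iSup (fun v : S => cyclicSubspace U (v : H)) ⟨v, hv⟩
      (circleCalculus_mem_cyclicSubspace U v f))
  have hmem : u ∈ S := by
    refine hS.2 (y := insert u S) ⟨?_, ?_⟩ (Set.subset_insert u S) (Set.mem_insert u S)
    · rintro v (rfl | hv)
      · exact hu1
      · exact hS.1.1 v hv
    · refine Set.pairwise_insert.2 ⟨hS.1.2, fun v hv _ =>
        ⟨(hortho v hv).symm, hortho v hv⟩⟩
  -- Maximality has put u in S, so its cyclic subspace is orthogonal to itself.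
  have h0 : inner ℂ u u = 0 := (hortho u hmem).inner_eq (self_mem_cyclicSubspace U u)
    (self_mem_cyclicSubspace U u)
  rw [inner_self_eq_zero] at h0
  simp [h0] at hu1

theorem cyclicSubspace_smul (U : unitary (H →L[ℂ] H)) (y : H) {c : ℂ} (hc : c ≠ 0) :
    cyclicSubspace U (c • y) = cyclicSubspace U y := by
  refine le_antisymm ?_ ?_ <;>
    refine cyclicSubspace_le (Submodule.isClosed_topologicalClosure _) fun f => ?_
  · rw [map_smul]
    exact Submodule.smul_mem _ _ (circleCalculus_mem_cyclicSubspace U y f)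
  · have h := circleCalculus_mem_cyclicSubspace U (c • y) (c⁻¹ • f)
    rwa [map_smul, map_smul, smul_apply, smul_inv_smul₀ hc] at h

/-- A separable Hilbert space is the Hilbert sum of countably many cyclic subspaces, whose
generators can be chosen with square-summable norms. -/
theorem exists_isHilbertSum_cyclicSubspace [TopologicalSpace.SeparableSpace H]
    (U : unitary (H →L[ℂ] H)) :
    ∃ (A : Set ℕ) (y : A → H), (∀ n, ‖y n‖ = (1 / 2) ^ (n : ℕ)) ∧
      IsHilbertSum ℂ (fun n => cyclicSubspace U (y n))
        (fun n => (cyclicSubspace U (y n)).subtypeₗᵢ) := by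
  obtain ⟨S, hS⟩ := exists_maximal_isCyclicSystem U
  have : Countable S := hS.1.countable
  obtain ⟨e, he⟩ := exists_injective_nat S
  let E := Equiv.ofInjective e he
  let y : Set.range e → H := fun n => (((1 / 2) ^ (n : ℕ) : ℝ) : ℂ) • (E.symm n : H)
  have hy (n : Set.range e) : cyclicSubspace U (y n) = cyclicSubspace U (E.symm n : H) :=
    cyclicSubspace_smul U _ (by simp)
  refine ⟨Set.range e, y, fun n => ?_, ?_⟩
  · simp [y, norm_smul, hS.1.1 _ (E.symm n).2]
  · have hcomplete (n : Set.range e) : CompleteSpace (cyclicSubspace U (y n)) :=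
      (Submodule.isClosed_topologicalClosure _).completeSpace_coe
    refine IsHilbertSum.mkInternal _ ?_ ?_
    · refine OrthogonalFamily.of_pairwise fun n m hnm => ?_
      simp only [Function.onFun, hy]
      refine hS.1.2 (E.symm n).2 (E.symm m).2 fun h => hnm ?_
      exact E.symm.injective (Subtype.ext h)
    · simp only [hy]
      rw [E.symm.iSup_comp (g := fun v : S => cyclicSubspace U (v : H)),
        dense_of_maximal_isCyclicSystem hS]
end
noncomputable section
-- The space L²(𝕋 × A) and multiplication by z
section Component
variable {A : Set ℕ}

theorem onComponent_apply (n : A) (f : C(Circle, ℂ)) (p : Circle × A) :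
    onComponent n f p = f p.1 * if p.2 = n then 1 else 0 := by
  simp [onComponent]

theorem continuous_onComponent (n : A) (f : C(Circle, ℂ)) : Continuous (onComponent n f) := by
  rw [funext (onComponent_apply n f)]
  exact (f.continuous.comp continuous_fst).mul
    ((continuous_of_discreteTopology (f := fun m : A => if m = n then (1 : ℂ) else 0)).comp
      continuous_snd)

theorem norm_onComponent_le (n : A) (f : C(Circle, ℂ)) (p : Circle × A) :
    ‖onComponent n f p‖ ≤ ‖f‖ := by
  unfold onComponent
  split_ifs
  · exact f.norm_coe_le_norm _
  · simp

theorem memLp_onComponent (ν : Measure (Circle × A)) [IsFiniteMeasure ν] (n : A)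
    (f : C(Circle, ℂ)) : MemLp (onComponent n f) 2 ν :=
  .of_bound (continuous_onComponent n f).aestronglyMeasurable ‖f‖
    (.of_forall (norm_onComponent_le n f))

theorem measurableEmbedding_component (n : A) :
    MeasurableEmbedding (fun z : Circle => (z, n)) :=
  measurableEmbedding_prod_mk_right n

theorem integral_onComponent (ν : Measure (Circle × A)) (n : A) (f : C(Circle, ℂ)) :
    ∫ p, onComponent n f p ∂ν = ∫ z, f z ∂(ν.comap fun z => (z, n)) := by
  have h := (measurableEmbedding_component n).integral_map (μ := ν.comap fun z => (z, n))
    (fun p => f p.1)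
  rw [← h, (measurableEmbedding_component n).map_comap,
    ← integral_indicator (measurableEmbedding_component n).measurableSet_range]
  congr 1
  ext ⟨z, m⟩
  have hmem : ((z, m) ∈ Set.range fun z : Circle => (z, n)) ↔ m = n := by
    simp [eq_comm]
  simp only [onComponent, Set.indicator, hmem]

theorem inner_onComponent (ν : Measure (Circle × A)) [IsFiniteMeasure ν] (n m : A)
    (f g : C(Circle, ℂ)) :
    inner ℂ ((memLp_onComponent ν n f).toLp) ((memLp_onComponent ν m g).toLp) =
      if n = m then ∫ z, star (f z) * g z ∂(ν.comap fun z => (z, n)) else 0 := by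
  rw [L2.inner_def]
  have h : ∫ p, inner ℂ (((memLp_onComponent ν n f).toLp _ : Lp ℂ 2 ν) p)
        (((memLp_onComponent ν m g).toLp _ : Lp ℂ 2 ν) p) ∂ν =
      ∫ p, star (onComponent n f p) * onComponent m g p ∂ν := by
    refine integral_congr_ae ?_
    filter_upwards [(memLp_onComponent ν n f).coeFn_toLp, (memLp_onComponent ν m g).coeFn_toLp]
      with p h₁ h₂
    rw [h₁, h₂, RCLike.inner_apply, mul_comm]
    rfl
  rw [h]
  split_ifs with hnm
  · subst hnm
    refine Eq.trans ?_ (integral_onComponent ν n (star f * g))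
    congr 1
    ext p
    simp only [onComponent]
    split_ifs <;> simp
  · rw [← integral_zero (Circle × A) ℂ]
    congr 1
    ext p
    simp only [onComponent]
    split_ifs with h₁ h₂
    · exact absurd (h₁.symm.trans h₂) hnm
    all_goals simp

theorem sum_onComponent {g : Circle × A → ℂ} (hg : Continuous g) (s : Finset A)
    (hs : ∀ p, p.2 ∉ s → g p = 0) :
    g = ∑ n ∈ s, onComponent n ⟨fun z => g (z, n), by fun_prop⟩ := by
  ext ⟨z, m⟩
  rw [Finset.sum_apply]
  simp only [onComponent, ContinuousMap.coe_mk, Finset.sum_ite_eq]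
  split_ifs with h
  · rfl
  · exact hs _ h

/-- The functions `onComponent n f` span a dense subspace of `L²(𝕋 × A, ν)`. -/
theorem dense_span_onComponent (ν : Measure (Circle × A)) [IsFiniteMeasure ν] :
    Dense (Submodule.span ℂ (Set.range fun i : A × C(Circle, ℂ) =>
      (memLp_onComponent ν i.1 i.2).toLp) : Set (Lp ℂ 2 ν)) := by
  intro F
  refine (mem_closure_iff_nhds_basis Metric.nhds_basis_closedEBall).2 fun ε hε => ?_
  obtain ⟨g, hgc, hgε, hg, hgL⟩ :=
    (Lp.memLp F).exists_hasCompactSupport_eLpNorm_sub_le (by simp) hε.ne'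
  -- A compact support meets only finitely many circles, as A is discrete; so the approximant g is a
  -- finite sum of functions living on one component.
  have hfin : (Prod.snd '' tsupport g).Finite := (hgc.isCompact.image continuous_snd).finite_of_discrete
  refine ⟨hgL.toLp g, ?_, ?_⟩
  · have hsum := sum_onComponent hg hfin.toFinset fun p hp => by
      by_contra h0
      exact hp (hfin.mem_toFinset.2 ⟨p, subset_tsupport g h0, rfl⟩)
    have hL : hgL.toLp g = ∑ n ∈ hfin.toFinset,
        (memLp_onComponent ν n ⟨fun z => g (z, n), by fun_prop⟩).toLp := by
      refine Lp.ext ?_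
      refine (hgL.coeFn_toLp).trans ?_
      refine .trans ?_ (Lp.coeFn_finsetSum _ _).symm
      have hall : ∀ᵐ p ∂ν, ∀ n : A,
          ((memLp_onComponent ν n ⟨fun z => g (z, n), by fun_prop⟩).toLp _ : Lp ℂ 2 ν) p =
            onComponent n ⟨fun z => g (z, n), by fun_prop⟩ p :=
        ae_all_iff.2 fun n => (memLp_onComponent ν n _).coeFn_toLp
      filter_upwards [hall] with p hp
      conv_lhs => rw [hsum]
      simp only [Finset.sum_apply, hp]
    rw [hL]
    exact Submodule.sum_mem _ fun n _ => Submodule.subset_span ⟨(n, _), rfl⟩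
  · rw [Metric.mem_closedEBall, edist_comm, Lp.edist_def]
    refine le_trans (le_of_eq (eLpNorm_congr_ae ?_)) hgε
    exact (Filter.EventuallyEq.refl _ _).sub hgL.coeFn_toLp

/-- Multiplication by the coordinate `z` on `L²(𝕋 × A, ν)`. -/
def mulCoord (ν : Measure (Circle × A)) : Lp ℂ 2 ν →L[ℂ] Lp ℂ 2 ν :=
  (ContinuousLinearMap.mul ℂ ℂ).holderL ν ⊤ 2 2
    ((memLp_top_of_bound (f := fun p : Circle × A => (p.1 : ℂ))
      (by fun_prop : Continuous fun p : Circle × A => (p.1 : ℂ)).aestronglyMeasurable 1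
      (.of_forall fun p => (Circle.norm_coe p.1).le)).toLp)

theorem coeFn_mulCoord (ν : Measure (Circle × A)) (F : Lp ℂ 2 ν) :
    mulCoord ν F =ᵐ[ν] fun p => (p.1 : ℂ) * F p := by
  refine ((ContinuousLinearMap.mul ℂ ℂ).coeFn_holder _ _).trans ?_
  filter_upwards [MemLp.coeFn_toLp (memLp_top_of_bound (f := fun p : Circle × A => (p.1 : ℂ))
      (by fun_prop : Continuous fun p : Circle × A => (p.1 : ℂ)).aestronglyMeasurable 1
      (.of_forall fun p => (Circle.norm_coe p.1).le))] with p hp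
  rw [hp]
  rfl

theorem mulCoord_onComponent (ν : Measure (Circle × A)) [IsFiniteMeasure ν] (n : A)
    (f : C(Circle, ℂ)) :
    mulCoord ν (memLp_onComponent ν n f).toLp =
      (memLp_onComponent ν n
        ((⟨fun z : Circle => (z : ℂ), continuous_subtype_val⟩ : C(Circle, ℂ)) * f)).toLp := by
  refine Lp.ext ?_
  filter_upwards [coeFn_mulCoord ν (memLp_onComponent ν n f).toLp,
    (memLp_onComponent ν n f).coeFn_toLp, (memLp_onComponent ν n
        ((⟨fun z : Circle => (z : ℂ), continuous_subtype_val⟩ : C(Circle, ℂ)) * f)).coeFn_toLp]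
    with p h₁ h₂ h₃
  rw [h₁, h₂, h₃]
  simp only [onComponent]
  split_ifs
  · rfl
  · simp

/-- The measure on `𝕋 × A` which restricts to `μ n` on the component `𝕋 × {n}`. -/
def componentSum (μ : A → Measure Circle) : Measure (Circle × A) :=
  Measure.sum fun n => (μ n).map fun z => (z, n)

theorem comap_componentSum (μ : A → Measure Circle) (n : A) :
    ((componentSum μ).comap fun z => (z, n)) = μ n := by
  ext s hs
  have he := measurableEmbedding_component n
  rw [he.comap_apply, componentSum, Measure.sum_apply _ (he.measurableSet_image.2 hs),
    tsum_eq_single n, (measurableEmbedding_component n).map_apply,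
    Set.preimage_image_eq _ he.injective]
  intro m hm
  rw [(measurableEmbedding_component m).map_apply]
  convert measure_empty (μ := μ m)
  ext z
  simp [hm.symm]

theorem componentSum_univ (μ : A → Measure Circle) :
    componentSum μ Set.univ = ∑' n, μ n Set.univ := by
  simp only [componentSum, Measure.sum_apply _ MeasurableSet.univ]
  exact tsum_congr fun n => by rw [(measurableEmbedding_component n).map_apply, Set.preimage_univ]

end Component

/-- The phase `(z, n) ↦ arg z`. -/
def circlePhase {A : Set ℕ} (p : Circle × A) : ℝ := Complex.arg (p.1 : ℂ)

theorem measurable_circlePhase {A : Set ℕ} : Measurable (circlePhase (A := A)) :=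
  Complex.measurable_arg.comp
    ((continuous_subtype_val.comp continuous_fst : Continuous fun p : Circle × A => (p.1 : ℂ)).measurable)

theorem exp_circlePhase {A : Set ℕ} (p : Circle × A) :
    Complex.exp (Complex.I * circlePhase p) = (p.1 : ℂ) := by
  have h := Complex.norm_mul_exp_arg_mul_I (p.1 : ℂ)
  rw [Circle.norm_coe, Complex.ofReal_one, one_mul] at h
  rw [mul_comm]
  exact h

/-! ### The unitary equivalence -/

variable {H : Type*} [NormedAddCommGroup H] [InnerProductSpace ℂ H] [CompleteSpace H]

/-- If `H` is the Hilbert sum of the cyclic subspaces of the `y n`, then `U` is unitarily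
equivalent to the multiplication by `z` on `L²` of the disjoint union of the spectral measures. -/
theorem exists_unitary_of_isHilbertSum (U : unitary (H →L[ℂ] H)) {A : Set ℕ} (y : A → H)
    (ν : Measure (Circle × A)) [IsFiniteMeasure ν]
    (hν : ∀ n, IsSpectralMeasure U (y n) (ν.comap fun z => (z, n)))
    (hy : IsHilbertSum ℂ (fun n => cyclicSubspace U (y n))
      (fun n => (cyclicSubspace U (y n)).subtypeₗᵢ)) :
    ∃ Θ : Lp ℂ 2 ν ≃ₗᵢ[ℂ] H,
      (∀ (n : A) (f : C(Circle, ℂ)),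
        Θ (memLp_onComponent ν n f).toLp = circleCalculus U f (y n)) ∧
      ∀ F : Lp ℂ 2 ν, Θ.symm ((U : H →L[ℂ] H) (Θ F)) = mulCoord ν F := by
  have hgram (i j : A × C(Circle, ℂ)) :
      inner ℂ ((memLp_onComponent ν i.1 i.2).toLp) ((memLp_onComponent ν j.1 j.2).toLp) =
        inner ℂ (circleCalculus U i.2 (y i.1)) (circleCalculus U j.2 (y j.1)) := by
    obtain ⟨n, f⟩ := i
    obtain ⟨m, g⟩ := j
    rw [inner_onComponent]
    split_ifs with hnm
    · simp only at hnm
      subst hnm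
      exact ((hν n).inner_eq_integral f g).symm
    · have h := hy.OrthogonalFamily hnm
        ⟨_, circleCalculus_mem_cyclicSubspace U (y n) f⟩
        ⟨_, circleCalculus_mem_cyclicSubspace U (y m) g⟩
      exact h.symm
  have hdense : Dense (Submodule.span ℂ (Set.range fun i : A × C(Circle, ℂ) =>
      circleCalculus U i.2 (y i.1)) : Set H) := by
    rw [Submodule.dense_iff_topologicalClosure_eq_top, eq_top_iff]
    have hcomplete (n : A) : CompleteSpace (cyclicSubspace U (y n)) :=
      (Submodule.isClosed_topologicalClosure _).completeSpace_coe
    -- The Hilbert sum isometry is onto, and its range is the closure of the sum of the cyclic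
    -- subspaces.
    have htop := LinearMap.range_eq_top.2 hy.surjective_isometry
    rw [hy.OrthogonalFamily.range_linearIsometry] at htop
    rw [← htop]
    refine Submodule.topologicalClosure_minimal _ (iSup_le fun n => ?_)
      (Submodule.isClosed_topologicalClosure _)
    rw [Submodule.subtypeₗᵢ_toLinearMap, Submodule.range_subtype]
    exact cyclicSubspace_le (Submodule.isClosed_topologicalClosure _) fun f =>
      Submodule.le_topologicalClosure _ (Submodule.subset_span ⟨(n, f), rfl⟩)
  obtain ⟨Θ, hΘ⟩ := exists_linearIsometryEquiv_of_inner_eq (𝕜 := ℂ) _ _ hgram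
    (dense_span_onComponent ν) hdense
  refine ⟨Θ, fun n f => hΘ (n, f), fun F => ?_⟩
  have h : (Θ.symm.toContinuousLinearEquiv : H →L[ℂ] Lp ℂ 2 ν) ∘L (U : H →L[ℂ] H) ∘L
      (Θ.toContinuousLinearEquiv : Lp ℂ 2 ν →L[ℂ] H) = mulCoord ν := by
    refine ContinuousLinearMap.ext_on (dense_span_onComponent ν) ?_
    rintro _ ⟨⟨n, f⟩, rfl⟩
    change Θ.symm ((U : H →L[ℂ] H) (Θ (memLp_onComponent ν n f).toLp)) =
      mulCoord ν (memLp_onComponent ν n f).toLp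
    rw [mulCoord_onComponent, LinearIsometryEquiv.symm_apply_eq]
    have h₁ := hΘ (n, f)
    have h₂ := hΘ (n, (⟨fun z : Circle => (z : ℂ), continuous_subtype_val⟩ : C(Circle, ℂ)) * f)
    simp only at h₁ h₂
    rw [h₁, h₂, map_mul, circleCalculus_coord, mul_apply_eq_comp]
  exact DFunLike.congr_fun h F
end
-- Transport to ℝ × A, where the phase is continuous
noncomputable section

/-- Unwinding of the circle: `(t, n) ↦ (e^{it}, n)`. -/
def expComponent {A : Set ℕ} (q : ℝ × A) : Circle × A := (Circle.exp q.1, q.2)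

/-- The Borel section `(z, n) ↦ (arg z, n)` of `expComponent`. -/
def argComponent {A : Set ℕ} (p : Circle × A) : ℝ × A := (circlePhase p, p.2)

theorem measurable_expComponent {A : Set ℕ} : Measurable (expComponent (A := A)) := by
  unfold expComponent
  fun_prop

theorem measurable_argComponent {A : Set ℕ} : Measurable (argComponent (A := A)) :=
  measurable_circlePhase.prodMk measurable_snd

theorem expComponent_argComponent {A : Set ℕ} (p : Circle × A) :
    expComponent (argComponent p) = p := by
  refine Prod.ext (Circle.ext ?_) rfl
  rw [← exp_circlePhase p, mul_comm]
  rfl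

theorem measurePreserving_argComponent {A : Set ℕ} (ν : Measure (Circle × A)) :
    MeasurePreserving argComponent ν (ν.map argComponent) :=
  measurable_argComponent.measurePreserving ν

theorem measurePreserving_expComponent {A : Set ℕ} (ν : Measure (Circle × A)) :
    MeasurePreserving expComponent (ν.map argComponent) ν := by
  refine ⟨measurable_expComponent, ?_⟩
  rw [Measure.map_map measurable_expComponent measurable_argComponent,
    show expComponent ∘ argComponent = (id : Circle × A → Circle × A) from
      funext expComponent_argComponent, Measure.map_id]

/-- The image measure lives on the range of the section, where arg inverts t ↦ e^{it}; elsewhere the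
two maps may differ by multiples of 2π. -/
theorem argComponent_expComponent_ae {A : Set ℕ} (ν : Measure (Circle × A)) :
    ∀ᵐ q ∂(ν.map argComponent), argComponent (expComponent q) = q := by
  have hs : MeasurableSet {q : ℝ × A | argComponent (expComponent q) = q} :=
    measurableSet_eq_fun (measurable_argComponent.comp measurable_expComponent) measurable_id
  rw [ae_map_iff measurable_argComponent.aemeasurable hs]
  exact .of_forall fun p => by rw [expComponent_argComponent]

/-- `L²(𝕋 × A, ν)` is identified with `L²` of the image of `ν` in `ℝ × A`. -/
def argEquiv {A : Set ℕ} (ν : Measure (Circle × A)) :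
    Lp ℂ 2 (ν.map argComponent) ≃ₗᵢ[ℂ] Lp ℂ 2 ν :=
  LinearIsometryEquiv.ofSurjective
    (Lp.compMeasurePreservingₗᵢ ℂ argComponent (measurePreserving_argComponent ν)) fun F => by
      refine ⟨Lp.compMeasurePreserving expComponent (measurePreserving_expComponent ν) F, ?_⟩
      change Lp.compMeasurePreserving argComponent (measurePreserving_argComponent ν)
        (Lp.compMeasurePreserving expComponent (measurePreserving_expComponent ν) F) = F
      rw [← Lp.compMeasurePreserving_comp_apply]
      refine Lp.ext ((Lp.coeFn_compMeasurePreserving F _).trans ?_)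
      exact .of_forall fun p => congrArg F (expComponent_argComponent p)

theorem coeFn_argEquiv {A : Set ℕ} (ν : Measure (Circle × A)) (F : Lp ℂ 2 (ν.map argComponent)) :
    argEquiv ν F =ᵐ[ν] F ∘ argComponent :=
  Lp.coeFn_compMeasurePreserving F (measurePreserving_argComponent ν)

theorem argEquiv_symm_mulCoord {A : Set ℕ} (ν : Measure (Circle × A))
    (F : Lp ℂ 2 (ν.map argComponent)) :
    (argEquiv ν).symm (mulCoord ν (argEquiv ν F)) =ᵐ[ν.map argComponent]
      fun q => Complex.exp (Complex.I * q.1) * F q := by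
  -- The inverse of composition with arg is composition with exp.
  have h : (argEquiv ν).symm (mulCoord ν (argEquiv ν F)) =
      Lp.compMeasurePreserving expComponent (measurePreserving_expComponent ν)
        (mulCoord ν (argEquiv ν F)) := by
    rw [LinearIsometryEquiv.symm_apply_eq]
    refine Lp.ext ?_
    refine .trans ?_ (coeFn_argEquiv ν _).symm
    have h' := (measurePreserving_argComponent ν).quasiMeasurePreserving.ae_eq_comp
      (Lp.coeFn_compMeasurePreserving (mulCoord ν (argEquiv ν F))
        (measurePreserving_expComponent ν))
    refine .trans ?_ h'.symm
    exact .of_forall fun p =>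
      congrArg (mulCoord ν (argEquiv ν F)) (expComponent_argComponent p).symm
  rw [h]
  refine (Lp.coeFn_compMeasurePreserving _ (measurePreserving_expComponent ν)).trans ?_
  have h₁ := (measurePreserving_expComponent ν).quasiMeasurePreserving.ae_eq_comp
    (coeFn_mulCoord ν (argEquiv ν F))
  have h₂ := (measurePreserving_expComponent ν).quasiMeasurePreserving.ae_eq_comp
    (coeFn_argEquiv ν F)
  filter_upwards [h₁, h₂, argComponent_expComponent_ae ν] with q hq₁ hq₂ hq₃
  rw [hq₁]
  simp only [Function.comp_apply] at hq₂ ⊢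
  rw [hq₂, hq₃, mul_comm Complex.I]
  rfl

variable {H : Type*} [NormedAddCommGroup H] [InnerProductSpace ℂ H] [CompleteSpace H]

/-- Each spectral measure has mass ‖yₙ‖² = 4⁻ⁿ, so the total mass is bounded by a geometric series.
-/
theorem exists_componentMeasure (U : unitary (H →L[ℂ] H)) {A : Set ℕ} (y : A → H)
    (hy : ∀ n, ‖y n‖ = (1 / 2) ^ (n : ℕ)) :
    ∃ ν : Measure (Circle × A), IsFiniteMeasure ν ∧
      ∀ n, IsSpectralMeasure U (y n) (ν.comap fun z => (z, n)) := by
  choose μ hμ using fun n => exists_isSpectralMeasure U (y n)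
  refine ⟨componentSum μ, ⟨?_⟩, fun n => by rw [comap_componentSum]; exact hμ n⟩
  rw [componentSum_univ]
  have hsum : Summable fun n : A => ‖y n‖ ^ 2 := by
    have h : Summable fun n : ℕ => ((1 / 4 : ℝ)) ^ n :=
      summable_geometric_of_lt_one (by norm_num) (by norm_num)
    refine (h.subtype A).congr fun n => ?_
    rw [hy, ← pow_mul, mul_comm, pow_mul]
    norm_num
  simp only [fun n => (hμ n).measure_univ]
  rw [← ENNReal.ofReal_tsum_of_nonneg (fun n => by positivity) hsum]
  exact ENNReal.ofReal_lt_top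
end
theorem mainTheorem4 {H : Type*} [NormedAddCommGroup H] [InnerProductSpace ℂ H] [CompleteSpace H]
    [TopologicalSpace.SeparableSpace H] (U : unitary (H →L[ℂ] H)) :
    -- a model with a continuous phase
    (∃ (X : Type) (_ : TopologicalSpace X) (_ : LocallyCompactSpace X) (_ : T2Space X)
      (_ : MeasurableSpace X) (_ : BorelSpace X)
      (ν : Measure X) (_ : IsFiniteMeasure ν) (_ : ν.Regular)
      (φ : X → ℝ) (Θ : Lp ℂ 2 ν ≃ₗᵢ[ℂ] H),
      Continuous φ ∧
      ∀ F : Lp ℂ 2 ν,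
        Θ.symm ((U : H →L[ℂ] H) (Θ F)) =ᵐ[ν] fun x => Complex.exp (Complex.I * φ x) * F x) ∧
    -- the concrete model on `𝕋 × A`, built from spectral measures of cyclic vectors
    (∃ (A : Set ℕ) (y : A → H) (ν : Measure (Circle × A)) (_ : IsFiniteMeasure ν)
      (φ : Circle × A → ℝ) (Θ : Lp ℂ 2 ν ≃ₗᵢ[ℂ] H),
      (∀ n, y n ≠ 0) ∧
      IsHilbertSum ℂ (fun n => cyclicSubspace U (y n))
        (fun n => (cyclicSubspace U (y n)).subtypeₗᵢ) ∧
      (∀ n, IsSpectralMeasure U (y n) (ν.comap fun z => (z, n))) ∧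
      (∀ (n : A) (f : C(Circle, ℂ)), ∃ hf : MemLp (onComponent n f) 2 ν,
        Θ (hf.toLp (onComponent n f)) = circleCalculus U f (y n)) ∧
      Measurable φ ∧
      (∀ p : Circle × A, Complex.exp (Complex.I * φ p) = (p.1 : ℂ)) ∧
      ∀ F : Lp ℂ 2 ν,
        Θ.symm ((U : H →L[ℂ] H) (Θ F)) =ᵐ[ν] fun p => Complex.exp (Complex.I * φ p) * F p) := by

  obtain ⟨A, y, hy, hsum⟩ := exists_isHilbertSum_cyclicSubspace U
  obtain ⟨ν, hfin, hν⟩ := exists_componentMeasure U y hy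
  obtain ⟨Θ, hΘ, hU⟩ := exists_unitary_of_isHilbertSum U y ν hν hsum
  refine ⟨⟨ℝ × A, inferInstance, inferInstance, inferInstance, inferInstance, inferInstance,
    ν.map argComponent, inferInstance, inferInstance, Prod.fst, (argEquiv ν).trans Θ,
    continuous_fst, fun F => ?_⟩, ⟨A, y, ν, hfin, circlePhase, Θ, fun n => ?_, hsum, hν,
    fun n f => ⟨memLp_onComponent ν n f, hΘ n f⟩, measurable_circlePhase, exp_circlePhase,
    fun F => ?_⟩⟩
  · rw [LinearIsometryEquiv.symm_trans, LinearIsometryEquiv.trans_apply,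
      LinearIsometryEquiv.trans_apply, hU]
    exact argEquiv_symm_mulCoord ν F
  · rw [← norm_pos_iff, hy]
    positivity
  · rw [hU]
    simp only [exp_circlePhase]
    exact coeFn_mulCoord ν F
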